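/- Let $\mathcal A$ be a pointed regular category with reflexive coequalizers, and write composites in diagrammatic order ($f\cdot g$ is $f$ followed by $g$). For a groupoid $\mathbb B=(d,c\colon B_1\rightrightarrows B_0,\ e,\ m,\ i)$ internal to $\mathcal A$, let $\eta_{\mathbb B}\colon B_0\to\pi_0(\mathbb B)$ be the coequalizer of $d$ and $c$, and let $\epsilon_{\mathbb B}\colon \pi_1(\mathbb B)\to B_1$ be the joint kernel $\mathrm{Ker}(d)\cap\mathrm{Ker}(c)$; both $\pi_0$ and $\pi_1$ are functorial in $\mathbb B$. Call $\mathbb B$ \emph{proper} if the factorization $B_1\to R[\eta_{\mathbb B}]$ of $(d,c)$ through the kernel pair of $\eta_{\mathbb B}$ is a regular epimorphism. A sequence $X\xrightarrow{f}Y\xrightarrow{g}Z$ in $\mathcal A$ is \emph{exact} at $Y$ if $f\cdot g=0$ and the factorization of $f$ through the kernel of $g$ is a regular epimorphism. In the 2-category of internal groupoids, internal functors and internal natural transformations, a strong h-pullback of $F\colon\mathbb A\to\mathbb B$ and $G\colon\mathbb C\to\mathbb B$ consists of functors $G'\colon\mathbb P\to\mathbb A$, $F'\colon\mathbb P\to\mathbb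 C$ and a 2-cell $\varphi\colon F'\cdot G\Rightarrow G'\cdot F$ such that: (1) for all $H\colon\mathbb X\to\mathbb A$, $K\colon\mathbb X\to\mathbb C$ and $\mu\colon K\cdot G\Rightarrow H\cdot F$ there is a unique $T\colon\mathbb X\to\mathbb P$ with $T\cdot G'=H$, $T\cdot F'=K$ and $T\cdot\varphi=\mu$; (2) for all $L,M\colon\mathbb X\rightrightarrows\mathbb P$ and 2-cells $\alpha\colon L\cdot F'\Rightarrow M\cdot F'$, $\beta\colon L\cdot G'\Rightarrow M\cdot G'$ such that $\alpha\cdot G$ followed by $M\cdot\varphi$ equals $L\cdot\varphi$ followed by $\beta\cdot F$, there is a unique 2-cell $\mu\colon L\Rightarrow M$ with $\mu\cdot F'=\alpha$ and $\mu\cdot G'=\beta$. Let $F\colon\mathbb A\to\mathbb B$ be an internal functor between groupoids in $\mathcal A$, and let $K(F)\colon\mathbb K(F)\to\mathbb A$, with 2-cell $k(F)\colon 0\Rightarrow K(F)\cdot F$, be a strong h-kernel of $F$, that is, a strong h-pullback of $F$ and the zero functor $0\to\mathbb B$ from the discrete groupoid on the zero object. Let $\Delta\colon\pi_1(\mathbb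 B)\to\mathbb K(F)_0$ be the unique arrow with $\Delta\cdot k(F)=\epsilon_{\mathbb B}$ and $\Delta\cdot K(F)_0=0$, and put $D=\Delta\cdot\eta_{\mathbb K(F)}\colon\pi_1(\mathbb B)\to\pi_0(\mathbb K(F))$. If $\mathbb A$, $\mathbb B$ and $\mathbb K(F)$ are proper, then the sequence $$\pi_1(\mathbb K(F))\xrightarrow{\pi_1(K(F))}\pi_1(\mathbb A)\xrightarrow{\pi_1(F)}\pi_1(\mathbb B)\xrightarrow{D}\pi_0(\mathbb K(F))\xrightarrow{\pi_0(K(F))}\pi_0(\mathbb A)\xrightarrow{\pi_0(F)}\pi_0(\mathbb B)$$ is exact at $\pi_1(\mathbb A)$, $\pi_1(\mathbb B)$, $\pi_0(\mathbb K(F))$ and $\pi_0(\mathbb A)$. -/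

import Mathlib

open CategoryTheory CategoryTheory.Limits
open scoped ZeroObject

universe v u

set_option linter.unusedSectionVars false

/-- A groupoid internal to a category `C` with finite limits: an object `obj` of objects, an object
`arr` of arrows, domain `d`, codomain `c`, identities `e`, composition
`m : arr ×_{c,d} arr ⟶ arr` (in diagrammatic order) and inversion `i`. Associativity is expressed on
generalized elements. -/
structure InternalGroupoid (C : Type u) [Category.{v} C] [HasFiniteLimits C] where
  obj : C
  arr : C
  d : arr ⟶ obj
  c : arr ⟶ obj
  e : obj ⟶ arr
  m : pullback c d ⟶ arr
  i : arr ⟶ arr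
  e_d : e ≫ d = 𝟙 obj
  e_c : e ≫ c = 𝟙 obj
  m_d : m ≫ d = pullback.fst c d ≫ d
  m_c : m ≫ c = pullback.snd c d ≫ c
  id_m : pullback.lift (d ≫ e) (𝟙 arr) (by simp [e_c]) ≫ m = 𝟙 arr
  m_id : pullback.lift (𝟙 arr) (c ≫ e) (by simp [e_d]) ≫ m = 𝟙 arr
  m_assoc : ∀ {X : C} (f g h : X ⟶ arr) (hfg : f ≫ c = g ≫ d) (hgh : g ≫ c = h ≫ d),
    pullback.lift (pullback.lift f g hfg ≫ m) h
        (by rw [Category.assoc, m_c, pullback.lift_snd_assoc, hgh]) ≫ m =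
      pullback.lift f (pullback.lift g h hgh ≫ m)
        (by rw [Category.assoc, m_d, pullback.lift_fst_assoc, hfg]) ≫ m
  i_d : i ≫ d = c
  i_c : i ≫ c = d
  m_inv : pullback.lift (𝟙 arr) i (by simp [i_d]) ≫ m = d ≫ e
  inv_m : pullback.lift i (𝟙 arr) (by simp [i_c]) ≫ m = c ≫ e

namespace InternalGroupoid

section Basic

variable {C : Type u} [Category.{v} C] [HasFiniteLimits C]

attribute [simp] e_d e_c i_d i_c

/-- The composite of two composable generalized arrows of an internal groupoid. -/
noncomputable def comp (B : InternalGroupoid C) {X : C} (f g : X ⟶ B.arr)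
    (h : f ≫ B.c = g ≫ B.d) : X ⟶ B.arr :=
  pullback.lift f g h ≫ B.m

@[simp]
theorem e_d_assoc (B : InternalGroupoid C) {Z : C} (z : B.obj ⟶ Z) : B.e ≫ B.d ≫ z = z := by
  rw [← Category.assoc, B.e_d, Category.id_comp]

@[simp]
theorem e_c_assoc (B : InternalGroupoid C) {Z : C} (z : B.obj ⟶ Z) : B.e ≫ B.c ≫ z = z := by
  rw [← Category.assoc, B.e_c, Category.id_comp]

@[simp]
theorem comp_d (B : InternalGroupoid C) {X : C} (f g : X ⟶ B.arr) (h : f ≫ B.c = g ≫ B.d) :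
    B.comp f g h ≫ B.d = f ≫ B.d := by
  rw [comp, Category.assoc, B.m_d, pullback.lift_fst_assoc]

@[simp]
theorem comp_c (B : InternalGroupoid C) {X : C} (f g : X ⟶ B.arr) (h : f ≫ B.c = g ≫ B.d) :
    B.comp f g h ≫ B.c = g ≫ B.c := by
  rw [comp, Category.assoc, B.m_c, pullback.lift_snd_assoc]

theorem precomp (B : InternalGroupoid C) {X Y : C} (u : Y ⟶ X) (f g : X ⟶ B.arr)
    (h : f ≫ B.c = g ≫ B.d) :
    u ≫ B.comp f g h = B.comp (u ≫ f) (u ≫ g) (by simp [h]) := by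
  rw [comp, comp, ← Category.assoc]
  congr 1
  ext <;> simp [pullback.lift_fst, pullback.lift_snd]

theorem comp_congr (B : InternalGroupoid C) {X : C} {f g f' g' : X ⟶ B.arr}
    (h : f ≫ B.c = g ≫ B.d) (hf : f = f') (hg : g = g') :
    B.comp f g h = B.comp f' g' (by rw [← hf, ← hg, h]) := by
  subst hf hg; rfl

theorem comp_assoc (B : InternalGroupoid C) {X : C} (f g k : X ⟶ B.arr)
    (h : f ≫ B.c = g ≫ B.d) (h' : g ≫ B.c = k ≫ B.d) :
    B.comp (B.comp f g h) k (by simp [h']) = B.comp f (B.comp g k h') (by simp [h]) :=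
  B.m_assoc f g k h h'

theorem unit_comp (B : InternalGroupoid C) {X : C} (x : X ⟶ B.obj) (f : X ⟶ B.arr)
    (h : x = f ≫ B.d) : B.comp (x ≫ B.e) f (by simp [h]) = f := by
  subst h
  have := f ≫= B.id_m
  rw [← comp, precomp] at this
  simpa using this

theorem comp_unit (B : InternalGroupoid C) {X : C} (f : X ⟶ B.arr) (x : X ⟶ B.obj)
    (h : f ≫ B.c = x) : B.comp f (x ≫ B.e) (by simp [h]) = f := by
  subst h
  have := f ≫= B.m_id
  rw [← comp, precomp] at this
  simpa using this

theorem comp_inv (B : InternalGroupoid C) {X : C} (f : X ⟶ B.arr) :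
    B.comp f (f ≫ B.i) (by simp) = f ≫ B.d ≫ B.e := by
  have := f ≫= B.m_inv
  rw [← comp, precomp] at this
  simpa using this

theorem inv_comp (B : InternalGroupoid C) {X : C} (f : X ⟶ B.arr) :
    B.comp (f ≫ B.i) f (by simp) = f ≫ B.c ≫ B.e := by
  have := f ≫= B.inv_m
  rw [← comp, precomp] at this
  simpa using this

/-- Internal functors between internal groupoids. -/
@[ext]
structure Functor (A B : InternalGroupoid C) where
  map₀ : A.obj ⟶ B.obj
  map₁ : A.arr ⟶ B.arr
  map_d : map₁ ≫ B.d = A.d ≫ map₀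
  map_c : map₁ ≫ B.c = A.c ≫ map₀
  map_e : A.e ≫ map₁ = map₀ ≫ B.e
  map_m : A.m ≫ map₁ =
    B.comp (pullback.fst A.c A.d ≫ map₁) (pullback.snd A.c A.d ≫ map₁)
      (by rw [Category.assoc, Category.assoc, map_c, map_d, pullback.condition_assoc])

/-- Internal groupoids and internal functors form a category. -/
noncomputable instance : Category (InternalGroupoid C) where
  Hom A B := Functor A B
  id A :=
    { map₀ := 𝟙 _
      map₁ := 𝟙 _
      map_d := by simp
      map_c := by simp
      map_e := by simp
      map_m := by
        have : pullback.lift (pullback.fst A.c A.d) (pullback.snd A.c A.d)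
            pullback.condition = 𝟙 _ := by ext <;> simp
        simp [comp, this] }
  comp {A B D} F G :=
    { map₀ := F.map₀ ≫ G.map₀
      map₁ := F.map₁ ≫ G.map₁
      map_d := by rw [Category.assoc, G.map_d, ← Category.assoc, F.map_d, Category.assoc]
      map_c := by rw [Category.assoc, G.map_c, ← Category.assoc, F.map_c, Category.assoc]
      map_e := by rw [← Category.assoc, F.map_e, Category.assoc, G.map_e, Category.assoc]
      map_m := by
        rw [← Category.assoc, F.map_m, comp, Category.assoc, G.map_m, precomp]
        apply comp_congr
        · rw [pullback.lift_fst_assoc, Category.assoc]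
        · rw [pullback.lift_snd_assoc, Category.assoc] }
  id_comp F := by apply Functor.ext <;> simp
  comp_id F := by apply Functor.ext <;> simp
  assoc F G H := by apply Functor.ext <;> simp

@[ext]
theorem hom_ext {A B : InternalGroupoid C} {F G : A ⟶ B} (h₀ : F.map₀ = G.map₀)
    (h₁ : F.map₁ = G.map₁) : F = G :=
  Functor.ext h₀ h₁

@[simp]
theorem id_map₀ (A : InternalGroupoid C) : Functor.map₀ (𝟙 A) = 𝟙 A.obj := rfl

@[simp]
theorem id_map₁ (A : InternalGroupoid C) : Functor.map₁ (𝟙 A) = 𝟙 A.arr := rfl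

@[simp]
theorem comp_map₀ {A B D : InternalGroupoid C} (F : A ⟶ B) (G : B ⟶ D) :
    (F ≫ G).map₀ = F.map₀ ≫ G.map₀ := rfl

@[simp]
theorem comp_map₁ {A B D : InternalGroupoid C} (F : A ⟶ B) (G : B ⟶ D) :
    (F ≫ G).map₁ = F.map₁ ≫ G.map₁ := rfl

@[simp]
theorem map_d {A B : InternalGroupoid C} (F : A ⟶ B) : F.map₁ ≫ B.d = A.d ≫ F.map₀ := F.map_d

@[simp]
theorem map_c {A B : InternalGroupoid C} (F : A ⟶ B) : F.map₁ ≫ B.c = A.c ≫ F.map₀ := F.map_c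

theorem comp_map {A B : InternalGroupoid C} (F : A ⟶ B) {X : C} (f g : X ⟶ A.arr)
    (h : f ≫ A.c = g ≫ A.d) :
    A.comp f g h ≫ F.map₁ = B.comp (f ≫ F.map₁) (g ≫ F.map₁)
      (by simp only [Category.assoc, map_c, map_d, reassoc_of% h]) := by
  rw [comp, Category.assoc, F.map_m, precomp]
  apply comp_congr
  · rw [pullback.lift_fst_assoc]
  · rw [pullback.lift_snd_assoc]

/-- Internal natural transformations `F ⇒ G`. -/
@[ext]
structure NatTrans {A B : InternalGroupoid C} (F G : A ⟶ B) where
  app : A.obj ⟶ B.arr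
  app_d : app ≫ B.d = F.map₀
  app_c : app ≫ B.c = G.map₀
  naturality : B.comp F.map₁ (A.c ≫ app) (by rw [Category.assoc, app_d, map_c]) =
    B.comp (A.d ≫ app) G.map₁ (by rw [Category.assoc, app_c, map_d])

attribute [simp] NatTrans.app_d NatTrans.app_c

/-- The whiskering `T · α : T · F ⇒ T · G`. -/
@[simps]
def whiskerLeft {X A B : InternalGroupoid C} (T : X ⟶ A) {F G : A ⟶ B} (α : NatTrans F G) :
    NatTrans (T ≫ F) (T ≫ G) where
  app := T.map₀ ≫ α.app
  app_d := by simp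
  app_c := by simp
  naturality := by
    have := T.map₁ ≫= α.naturality
    rw [precomp, precomp] at this
    refine Eq.trans (comp_congr _ _ rfl ?_) (this.trans (comp_congr _ _ ?_ rfl))
    · rw [← Category.assoc, ← map_c, Category.assoc]
    · rw [← Category.assoc, map_d, Category.assoc]

/-- The whiskering `α · G : L · G ⇒ M · G`. -/
@[simps]
def whiskerRight {X A B : InternalGroupoid C} {L M : X ⟶ A} (α : NatTrans L M) (G : A ⟶ B) :
    NatTrans (L ≫ G) (M ≫ G) where
  app := α.app ≫ G.map₁
  app_d := by rw [Category.assoc, map_d, ← Category.assoc, α.app_d, comp_map₀]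
  app_c := by rw [Category.assoc, map_c, ← Category.assoc, α.app_c, comp_map₀]
  naturality := by
    have := α.naturality =≫ G.map₁
    rw [comp_map, comp_map] at this
    simpa using this

/-- A square filled with a 2-cell `left · G ⇒ top · F`, over functors `F : A ⟶ B` and
`G : D ⟶ B`. -/
structure HSquare {A D B : InternalGroupoid C} (F : A ⟶ B) (G : D ⟶ B) where
  pt : InternalGroupoid C
  top : pt ⟶ A
  left : pt ⟶ D
  cell : NatTrans (left ≫ G) (top ≫ F)

/-- The square `S` is a strong h-pullback of `F` and `G` in the 2-category of internal groupoids: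
it has the one-dimensional universal property (strictly), and the two-dimensional one. -/
structure HSquare.IsStrongHPullback {A D B : InternalGroupoid C} {F : A ⟶ B} {G : D ⟶ B}
    (S : HSquare F G) : Prop where
  existsUnique_functor : ∀ R : HSquare F G, ∃! T : R.pt ⟶ S.pt,
    T ≫ S.top = R.top ∧ T ≫ S.left = R.left ∧ (whiskerLeft T S.cell).app = R.cell.app
  existsUnique_natTrans : ∀ {X : InternalGroupoid C} (L M : X ⟶ S.pt)
    (α : NatTrans (L ≫ S.left) (M ≫ S.left)) (β : NatTrans (L ≫ S.top) (M ≫ S.top)),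
    B.comp (whiskerRight α G).app (whiskerLeft M S.cell).app
        (by rw [NatTrans.app_c, NatTrans.app_d]; simp) =
      B.comp (whiskerLeft L S.cell).app (whiskerRight β F).app
        (by rw [NatTrans.app_c, NatTrans.app_d]; simp) →
    ∃! μ : NatTrans L M, whiskerRight μ S.left = α ∧ whiskerRight μ S.top = β

/-- The discrete groupoid `X ⇉ X`. -/
@[simps obj arr d c e i]
noncomputable def discrete (X : C) : InternalGroupoid C where
  obj := X
  arr := X
  d := 𝟙 X
  c := 𝟙 X
  e := 𝟙 X
  m := pullback.fst (𝟙 X) (𝟙 X)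
  i := 𝟙 X
  e_d := by simp
  e_c := by simp
  m_d := rfl
  m_c := pullback.condition
  id_m := by rw [pullback.lift_fst, Category.comp_id]
  m_id := pullback.lift_fst _ _ _
  m_assoc f g h hfg hgh := by rw [pullback.lift_fst, pullback.lift_fst, pullback.lift_fst]
  i_d := by simp
  i_c := by simp
  m_inv := by rw [pullback.lift_fst, Category.comp_id]
  inv_m := by rw [pullback.lift_fst, Category.comp_id]

/-- The functor out of a discrete groupoid determined by a morphism to the object of objects. -/
@[simps]
noncomputable def ofDiscrete {X : C} (A : InternalGroupoid C) (x : X ⟶ A.obj) :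
    discrete X ⟶ A where
  map₀ := x
  map₁ := x ≫ A.e
  map_d := (show (x ≫ A.e) ≫ A.d = 𝟙 X ≫ x by simp)
  map_c := (show (x ≫ A.e) ≫ A.c = 𝟙 X ≫ x by simp)
  map_e := Category.id_comp _
  map_m := by
    have h : pullback.fst (𝟙 X) (𝟙 X) = pullback.snd (𝟙 X) (𝟙 X) := by
      simpa using pullback.condition (f := 𝟙 X) (g := 𝟙 X)
    change pullback.fst (𝟙 X) (𝟙 X) ≫ x ≫ A.e = A.comp (pullback.fst (𝟙 X) (𝟙 X) ≫ x ≫ A.e)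
      (pullback.snd (𝟙 X) (𝟙 X) ≫ x ≫ A.e) _
    have h2 := A.comp_unit (pullback.fst (𝟙 X) (𝟙 X) ≫ x ≫ A.e) (pullback.snd (𝟙 X) (𝟙 X) ≫ x)
      (by simp [h])
    simpa using h2.symm

end Basic

section Pi

variable {C : Type u} [Category.{v} C] [HasFiniteLimits C]

instance (B : InternalGroupoid C) : IsReflexivePair B.d B.c :=
  IsReflexivePair.mk' B.e B.e_d B.e_c

section PiZero

variable [HasReflexiveCoequalizers C]

/-- The quotient `η : B₀ ⟶ π₀(B)`, the coequalizer of domain and codomain. -/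
noncomputable def η (B : InternalGroupoid C) : B.obj ⟶ coequalizer B.d B.c :=
  coequalizer.π B.d B.c

theorem η_condition (B : InternalGroupoid C) : B.d ≫ B.η = B.c ≫ B.η :=
  coequalizer.condition B.d B.c

/-- The functor `π₀` of connected components. -/
@[simps obj]
noncomputable def π₀ : InternalGroupoid C ⥤ C where
  obj B := coequalizer B.d B.c
  map {A B} F := coequalizer.desc (F.map₀ ≫ B.η) (by
    rw [← Category.assoc, ← map_d, Category.assoc, η_condition, ← Category.assoc, map_c,
      Category.assoc])
  map_id A := by ext; simp [η]
  map_comp F G := by ext; simp [η]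

/-- The morphism `π₀(F)` is the unique one with `η · π₀(F) = F₀ · η`. -/
theorem η_π₀_map {A B : InternalGroupoid C} (F : A ⟶ B) :
    A.η ≫ π₀.map F = F.map₀ ≫ B.η := by
  exact coequalizer.π_desc _ _

/-- An internal groupoid is proper if the factorization of `(d, c)` through the kernel pair of
`η` is a regular epimorphism. -/
def IsProper (B : InternalGroupoid C) : Prop :=
  IsRegularEpi (pullback.lift B.d B.c B.η_condition : B.arr ⟶ pullback B.η B.η)

end PiZero

section PiOne

variable [HasZeroMorphisms C]

/-- The inclusion `ε : π₁(B) ⟶ B₁` of the joint kernel of domain and codomain. -/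
noncomputable def ε (B : InternalGroupoid C) : kernel (prod.lift B.d B.c) ⟶ B.arr :=
  kernel.ι (prod.lift B.d B.c)

@[simp]
theorem ε_d (B : InternalGroupoid C) : B.ε ≫ B.d = 0 := by
  have := kernel.condition (prod.lift B.d B.c) =≫ prod.fst
  rwa [Category.assoc, prod.lift_fst, zero_comp] at this

@[simp]
theorem ε_c (B : InternalGroupoid C) : B.ε ≫ B.c = 0 := by
  have := kernel.condition (prod.lift B.d B.c) =≫ prod.snd
  rwa [Category.assoc, prod.lift_snd, zero_comp] at this

/-- The functor `π₁` of automorphisms of the base point (with values in the base category). -/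
@[simps obj]
noncomputable def π₁ : InternalGroupoid C ⥤ C where
  obj B := kernel (prod.lift B.d B.c)
  map {A B} F := kernel.lift (prod.lift B.d B.c) (A.ε ≫ F.map₁) (by
    ext
    · rw [Category.assoc, prod.lift_fst, Category.assoc, map_d, ← Category.assoc, ε_d, zero_comp,
        zero_comp]
    · rw [Category.assoc, prod.lift_snd, Category.assoc, map_c, ← Category.assoc, ε_c, zero_comp,
        zero_comp])
  map_id A := by ext; simp [ε]
  map_comp F G := by ext; simp [ε]

/-- The morphism `π₁(F)` is the unique one with `π₁(F) · ε = ε · F₁`. -/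
theorem π₁_map_ε {A B : InternalGroupoid C} (F : A ⟶ B) :
    π₁.map F ≫ B.ε = A.ε ≫ F.map₁ := by
  exact kernel.lift_ι _ _ _

end PiOne

end Pi

section Kernel

variable {C : Type u} [Category.{v} C] [HasFiniteLimits C] [HasZeroObject C] [HasZeroMorphisms C]

/-- The zero functor from the discrete groupoid on the zero object. -/
noncomputable def zeroFunctor (B : InternalGroupoid C) : discrete (0 : C) ⟶ B :=
  ofDiscrete B 0

/-- A square over `F` and the zero functor, which is a strong h-pullback: a strong h-kernel
`K(F) = top : 𝕂(F) ⟶ A` of `F` with its 2-cell `cell : 0 ⇒ K(F) · F`. -/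
abbrev IsStrongHKernel {A B : InternalGroupoid C} {F : A ⟶ B}
    (K : HSquare F B.zeroFunctor) : Prop :=
  K.IsStrongHPullback

@[simp]
theorem HSquare.cell_d {A B : InternalGroupoid C} {F : A ⟶ B} (K : HSquare F B.zeroFunctor) :
    K.cell.app ≫ B.d = 0 := by
  rw [NatTrans.app_d, comp_map₀]
  exact comp_zero

theorem toDiscreteZero_ext {X : InternalGroupoid C} (f g : X ⟶ discrete (0 : C)) : f = g := by
  apply hom_ext
  · exact (isZero_zero C).eq_of_tgt _ _
  · exact (isZero_zero C).eq_of_tgt _ _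

/-- A 2-cell `0 ⇒ x · F` between functors out of a discrete groupoid. -/
noncomputable def discreteCell {A B : InternalGroupoid C} (F : A ⟶ B) {X : C} (x : X ⟶ A.obj)
    (b : X ⟶ B.arr) (hd : b ≫ B.d = 0) (hc : b ≫ B.c = x ≫ F.map₀) :
    NatTrans (ofDiscrete (discrete (0 : C)) (0 : X ⟶ 0) ≫ B.zeroFunctor) (ofDiscrete A x ≫ F) where
  app := b
  app_d := hd.trans comp_zero.symm
  app_c := hc
  naturality := by
    have e1 : ((0 : X ⟶ (0 : C)) ≫ 𝟙 (0 : C)) ≫ ((0 : (0 : C) ⟶ B.obj) ≫ B.e) =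
        (0 : X ⟶ B.obj) ≫ B.e := by simp
    have e2 : (x ≫ A.e) ≫ F.map₁ = (x ≫ F.map₀) ≫ B.e := by
      rw [Category.assoc, F.map_e, Category.assoc]
    exact (B.comp_congr _ e1 (Category.id_comp b)).trans ((B.unit_comp _ _ hd.symm).trans
      ((B.comp_congr _ (Category.id_comp b) e2).trans (B.comp_unit _ _ hc)).symm)

/-- The universal property of `𝕂(F)₀` as the limit of `0 ⟶ B₀ ⟵ B₁ ⟶ B₀ ⟵ A₀`. -/
theorem existsUnique_toHKernel {A B : InternalGroupoid C} {F : A ⟶ B}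
    {K : HSquare F B.zeroFunctor} (hK : IsStrongHKernel K) {X : C} (x : X ⟶ A.obj)
    (b : X ⟶ B.arr) (hd : b ≫ B.d = 0) (hc : b ≫ B.c = x ≫ F.map₀) :
    ∃! y : X ⟶ K.pt.obj, y ≫ K.cell.app = b ∧ y ≫ K.top.map₀ = x := by
  obtain ⟨T, ⟨h1, _, h3⟩, hu⟩ := hK.existsUnique_functor
    { pt := discrete X
      top := ofDiscrete A x
      left := ofDiscrete (discrete (0 : C)) (0 : X ⟶ 0)
      cell := discreteCell F x b hd hc }
  refine ⟨T.map₀, ⟨h3, congrArg Functor.map₀ h1⟩, ?_⟩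
  rintro y ⟨k1, k2⟩
  have : ofDiscrete K.pt y = T := by
    apply hu
    refine ⟨?_, toDiscreteZero_ext _ _, k1⟩
    have h : (y ≫ K.pt.e) ≫ K.top.map₁ = x ≫ A.e := by
      rw [Category.assoc, K.top.map_e, ← Category.assoc, k2]
    exact hom_ext k2 h
  exact congrArg Functor.map₀ this

/-- The unique morphism `Δ : π₁(B) ⟶ 𝕂(F)₀` with `Δ · k(F) = ε` and `Δ · K(F)₀ = 0`. -/
theorem existsUnique_delta {A B : InternalGroupoid C} {F : A ⟶ B} {K : HSquare F B.zeroFunctor}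
    (hK : IsStrongHKernel K) :
    ∃! Δ : π₁.obj B ⟶ K.pt.obj, Δ ≫ K.cell.app = B.ε ∧ Δ ≫ K.top.map₀ = 0 :=
  existsUnique_toHKernel hK 0 B.ε B.ε_d (by rw [ε_c, zero_comp])

theorem comp_zeroFunctor_map₁ (B : InternalGroupoid C) {Y : C} (a : Y ⟶ (0 : C)) :
    a ≫ B.zeroFunctor.map₁ = (0 : Y ⟶ B.obj) ≫ B.e := by
  have h : B.zeroFunctor.map₁ = (0 : (0 : C) ⟶ B.arr) := zero_comp
  rw [h]
  exact comp_zero.trans zero_comp.symm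

/-- The object of objects of the strong h-kernel. -/
noncomputable abbrev hKer₀ {A B : InternalGroupoid C} (F : A ⟶ B) : C :=
  pullback (kernel.ι B.d ≫ B.c) F.map₀

/-- The projection `k(F) : 𝕂(F)₀ ⟶ B₁`. -/
noncomputable def hKerCell {A B : InternalGroupoid C} (F : A ⟶ B) : hKer₀ F ⟶ B.arr :=
  pullback.fst (kernel.ι B.d ≫ B.c) F.map₀ ≫ kernel.ι B.d

/-- The projection `K(F)₀ : 𝕂(F)₀ ⟶ A₀`. -/
noncomputable def hKerTop₀ {A B : InternalGroupoid C} (F : A ⟶ B) : hKer₀ F ⟶ A.obj :=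
  pullback.snd (kernel.ι B.d ≫ B.c) F.map₀

@[simp]
theorem hKerCell_d {A B : InternalGroupoid C} (F : A ⟶ B) : hKerCell F ≫ B.d = 0 := by
  rw [hKerCell, Category.assoc, kernel.condition, comp_zero]

@[simp]
theorem hKerCell_c {A B : InternalGroupoid C} (F : A ⟶ B) :
    hKerCell F ≫ B.c = hKerTop₀ F ≫ F.map₀ := by
  rw [hKerCell, Category.assoc, pullback.condition]; rfl

/-- Morphisms into `𝕂(F)₀`. -/
noncomputable def hKerLift {A B : InternalGroupoid C} (F : A ⟶ B) {X : C} (x : X ⟶ A.obj)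
    (b : X ⟶ B.arr) (hd : b ≫ B.d = 0) (hc : b ≫ B.c = x ≫ F.map₀) : X ⟶ hKer₀ F :=
  pullback.lift (kernel.lift B.d b hd) x (by rw [kernel.lift_ι_assoc, hc])

@[simp]
theorem hKerLift_cell {A B : InternalGroupoid C} (F : A ⟶ B) {X : C} (x : X ⟶ A.obj)
    (b : X ⟶ B.arr) (hd : b ≫ B.d = 0) (hc : b ≫ B.c = x ≫ F.map₀) :
    hKerLift F x b hd hc ≫ hKerCell F = b := by
  rw [hKerLift, hKerCell, pullback.lift_fst_assoc, kernel.lift_ι]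

@[simp]
theorem hKerLift_top {A B : InternalGroupoid C} (F : A ⟶ B) {X : C} (x : X ⟶ A.obj)
    (b : X ⟶ B.arr) (hd : b ≫ B.d = 0) (hc : b ≫ B.c = x ≫ F.map₀) :
    hKerLift F x b hd hc ≫ hKerTop₀ F = x := by
  rw [hKerLift, hKerTop₀, pullback.lift_snd]

@[simp]
theorem hKerLift_cell_assoc {A B : InternalGroupoid C} (F : A ⟶ B) {X Z : C} (x : X ⟶ A.obj)
    (b : X ⟶ B.arr) (hd : b ≫ B.d = 0) (hc : b ≫ B.c = x ≫ F.map₀) (z : B.arr ⟶ Z) :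
    hKerLift F x b hd hc ≫ hKerCell F ≫ z = b ≫ z := by
  rw [← Category.assoc, hKerLift_cell]

@[simp]
theorem hKerLift_top_assoc {A B : InternalGroupoid C} (F : A ⟶ B) {X Z : C} (x : X ⟶ A.obj)
    (b : X ⟶ B.arr) (hd : b ≫ B.d = 0) (hc : b ≫ B.c = x ≫ F.map₀) (z : A.obj ⟶ Z) :
    hKerLift F x b hd hc ≫ hKerTop₀ F ≫ z = x ≫ z := by
  rw [← Category.assoc, hKerLift_top]

theorem hKer₀_ext {A B : InternalGroupoid C} {F : A ⟶ B} {X : C} {f g : X ⟶ hKer₀ F}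
    (h₁ : f ≫ hKerCell F = g ≫ hKerCell F) (h₂ : f ≫ hKerTop₀ F = g ≫ hKerTop₀ F) : f = g := by
  apply pullback.hom_ext
  · rw [← cancel_mono (kernel.ι B.d)]
    simpa [hKerCell] using h₁
  · exact h₂

/-- The object of arrows of the strong h-kernel: an arrow is given by its domain in `𝕂(F)₀`
together with an arrow of `A`. -/
noncomputable abbrev hKer₁ {A B : InternalGroupoid C} (F : A ⟶ B) : C :=
  pullback (hKerTop₀ F) A.d

/-- The domain of arrows in `𝕂(F)`. -/
noncomputable def hKerD {A B : InternalGroupoid C} (F : A ⟶ B) : hKer₁ F ⟶ hKer₀ F :=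
  pullback.fst (hKerTop₀ F) A.d

/-- The projection `K(F)₁ : 𝕂(F)₁ ⟶ A₁`. -/
noncomputable def hKerTop₁ {A B : InternalGroupoid C} (F : A ⟶ B) : hKer₁ F ⟶ A.arr :=
  pullback.snd (hKerTop₀ F) A.d

@[simp]
theorem hKerTop₁_d {A B : InternalGroupoid C} (F : A ⟶ B) :
    hKerTop₁ F ≫ A.d = hKerD F ≫ hKerTop₀ F :=
  pullback.condition.symm

/-- Morphisms into `𝕂(F)₁`. -/
noncomputable def hKerLift₁ {A B : InternalGroupoid C} (F : A ⟶ B) {X : C} (x : X ⟶ hKer₀ F)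
    (a : X ⟶ A.arr) (h : x ≫ hKerTop₀ F = a ≫ A.d) : X ⟶ hKer₁ F :=
  pullback.lift x a h

@[simp]
theorem hKerLift₁_d {A B : InternalGroupoid C} (F : A ⟶ B) {X : C} (x : X ⟶ hKer₀ F)
    (a : X ⟶ A.arr) (h : x ≫ hKerTop₀ F = a ≫ A.d) : hKerLift₁ F x a h ≫ hKerD F = x :=
  pullback.lift_fst _ _ _

@[simp]
theorem hKerLift₁_top {A B : InternalGroupoid C} (F : A ⟶ B) {X : C} (x : X ⟶ hKer₀ F)
    (a : X ⟶ A.arr) (h : x ≫ hKerTop₀ F = a ≫ A.d) : hKerLift₁ F x a h ≫ hKerTop₁ F = a :=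
  pullback.lift_snd _ _ _

@[simp]
theorem hKerLift₁_d_assoc {A B : InternalGroupoid C} (F : A ⟶ B) {X Z : C} (x : X ⟶ hKer₀ F)
    (a : X ⟶ A.arr) (h : x ≫ hKerTop₀ F = a ≫ A.d) (z : hKer₀ F ⟶ Z) :
    hKerLift₁ F x a h ≫ hKerD F ≫ z = x ≫ z :=
  pullback.lift_fst_assoc _ _ _ _

@[simp]
theorem hKerLift₁_top_assoc {A B : InternalGroupoid C} (F : A ⟶ B) {X Z : C} (x : X ⟶ hKer₀ F)
    (a : X ⟶ A.arr) (h : x ≫ hKerTop₀ F = a ≫ A.d) (z : A.arr ⟶ Z) :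
    hKerLift₁ F x a h ≫ hKerTop₁ F ≫ z = a ≫ z :=
  pullback.lift_snd_assoc _ _ _ _

theorem hKer₁_ext {A B : InternalGroupoid C} {F : A ⟶ B} {X : C} {f g : X ⟶ hKer₁ F}
    (h₁ : f ≫ hKerD F = g ≫ hKerD F) (h₂ : f ≫ hKerTop₁ F = g ≫ hKerTop₁ F) : f = g :=
  pullback.hom_ext h₁ h₂

theorem hKerD_composable {A B : InternalGroupoid C} (F : A ⟶ B) :
    (hKerD F ≫ hKerCell F) ≫ B.c = (hKerTop₁ F ≫ F.map₁) ≫ B.d := by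
  rw [Category.assoc, Category.assoc, hKerCell_c, map_d, ← Category.assoc, ← hKerTop₁_d,
    Category.assoc]

/-- The codomain of arrows in `𝕂(F)`. -/
noncomputable def hKerC {A B : InternalGroupoid C} (F : A ⟶ B) : hKer₁ F ⟶ hKer₀ F :=
  hKerLift F (hKerTop₁ F ≫ A.c)
    (B.comp (hKerD F ≫ hKerCell F) (hKerTop₁ F ≫ F.map₁) (hKerD_composable F))
    (by simp) (by simp)

@[simp]
theorem hKerC_top {A B : InternalGroupoid C} (F : A ⟶ B) :
    hKerC F ≫ hKerTop₀ F = hKerTop₁ F ≫ A.c := by simp [hKerC]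

theorem hKerC_cell {A B : InternalGroupoid C} (F : A ⟶ B) :
    hKerC F ≫ hKerCell F =
      B.comp (hKerD F ≫ hKerCell F) (hKerTop₁ F ≫ F.map₁) (hKerD_composable F) := by
  simp [hKerC]

theorem hKer_composable {A B : InternalGroupoid C} (F : A ⟶ B) {X : C} {f g : X ⟶ hKer₁ F}
    (h : f ≫ hKerC F = g ≫ hKerD F) : (f ≫ hKerTop₁ F) ≫ A.c = (g ≫ hKerTop₁ F) ≫ A.d := by
  rw [Category.assoc, ← hKerC_top, reassoc_of% h, Category.assoc, hKerTop₁_d]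

/-- Composition of arrows in `𝕂(F)`. -/
noncomputable def hKerComp {A B : InternalGroupoid C} (F : A ⟶ B) {X : C} (f g : X ⟶ hKer₁ F)
    (h : f ≫ hKerC F = g ≫ hKerD F) : X ⟶ hKer₁ F :=
  hKerLift₁ F (f ≫ hKerD F) (A.comp (f ≫ hKerTop₁ F) (g ≫ hKerTop₁ F) (hKer_composable F h))
    (by simp)

@[simp]
theorem hKerComp_d {A B : InternalGroupoid C} (F : A ⟶ B) {X : C} (f g : X ⟶ hKer₁ F)
    (h : f ≫ hKerC F = g ≫ hKerD F) : hKerComp F f g h ≫ hKerD F = f ≫ hKerD F := by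
  simp [hKerComp]

theorem hKerComp_top {A B : InternalGroupoid C} (F : A ⟶ B) {X : C} (f g : X ⟶ hKer₁ F)
    (h : f ≫ hKerC F = g ≫ hKerD F) : hKerComp F f g h ≫ hKerTop₁ F =
      A.comp (f ≫ hKerTop₁ F) (g ≫ hKerTop₁ F) (hKer_composable F h) := by
  simp [hKerComp]

theorem hKerComp_c {A B : InternalGroupoid C} (F : A ⟶ B) {X : C} (f g : X ⟶ hKer₁ F)
    (h : f ≫ hKerC F = g ≫ hKerD F) : hKerComp F f g h ≫ hKerC F = g ≫ hKerC F := by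
  apply hKer₀_ext
  · rw [Category.assoc, Category.assoc, hKerC_cell, precomp, precomp]
    have h1 : hKerComp F f g h ≫ hKerTop₁ F ≫ F.map₁ =
        B.comp (f ≫ hKerTop₁ F ≫ F.map₁) (g ≫ hKerTop₁ F ≫ F.map₁)
          (by
            rw [Category.assoc, Category.assoc, Category.assoc, Category.assoc, map_c, map_d,
              ← Category.assoc, ← Category.assoc, hKer_composable F h, Category.assoc,
              Category.assoc]) := by
      rw [← Category.assoc, hKerComp_top, comp_map]
      apply comp_congr <;> simp
    have h2 : g ≫ hKerD F ≫ hKerCell F =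
        B.comp (f ≫ hKerD F ≫ hKerCell F) (f ≫ hKerTop₁ F ≫ F.map₁)
          (by simpa using f ≫= hKerD_composable F) := by
      rw [← Category.assoc, ← h, Category.assoc, hKerC_cell, precomp]
    have h3 : hKerComp F f g h ≫ hKerD F ≫ hKerCell F = f ≫ hKerD F ≫ hKerCell F := by
      rw [← Category.assoc, hKerComp_d, Category.assoc]
    exact (B.comp_congr _ h3 h1).trans ((B.comp_assoc _ _ _ _ _).symm.trans
      (B.comp_congr _ h2.symm rfl))
  · simp [hKerComp]

theorem hKerComp_precomp {A B : InternalGroupoid C} (F : A ⟶ B) {X Y : C} (u : Y ⟶ X)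
    (f g : X ⟶ hKer₁ F) (h : f ≫ hKerC F = g ≫ hKerD F) :
    u ≫ hKerComp F f g h = hKerComp F (u ≫ f) (u ≫ g) (by simp [h]) := by
  apply hKer₁_ext
  · simp
  · rw [Category.assoc, hKerComp_top, hKerComp_top, precomp]
    apply comp_congr <;> simp

/-- The identities of `𝕂(F)`. -/
noncomputable def hKerE {A B : InternalGroupoid C} (F : A ⟶ B) : hKer₀ F ⟶ hKer₁ F :=
  hKerLift₁ F (𝟙 _) (hKerTop₀ F ≫ A.e) (by simp)

theorem hKerE_c {A B : InternalGroupoid C} (F : A ⟶ B) : hKerE F ≫ hKerC F = 𝟙 _ := by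
  apply hKer₀_ext
  · rw [Category.assoc, hKerC_cell, precomp]
    refine (B.comp_congr (f' := hKerCell F) (g' := (hKerTop₀ F ≫ F.map₀) ≫ B.e) _ ?_ ?_).trans
      ((B.comp_unit _ _ (by simp)).trans (Category.id_comp _).symm)
    · simp [hKerE]
    · rw [hKerE, ← Category.assoc, hKerLift₁_top, Category.assoc, F.map_e, Category.assoc]
  · simp [hKerE]

/-- The inverses in `𝕂(F)`. -/
noncomputable def hKerI {A B : InternalGroupoid C} (F : A ⟶ B) : hKer₁ F ⟶ hKer₁ F :=
  hKerLift₁ F (hKerC F) (hKerTop₁ F ≫ A.i) (by simp)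

theorem hKerI_d {A B : InternalGroupoid C} (F : A ⟶ B) : hKerI F ≫ hKerD F = hKerC F := by
  simp [hKerI]

theorem hKerI_comp {A B : InternalGroupoid C} (F : A ⟶ B) :
    hKerComp F (𝟙 _) (hKerI F) (by rw [hKerI_d, Category.id_comp]) = hKerD F ≫ hKerE F := by
  apply hKer₁_ext
  · simp [hKerE]
  · rw [hKerComp_top]
    refine (A.comp_congr (f' := hKerTop₁ F) (g' := hKerTop₁ F ≫ A.i) _ ?_ ?_).trans
      ((A.comp_inv _).trans ?_)
    · simp
    · simp [hKerI]
    · rw [← Category.assoc, hKerTop₁_d, Category.assoc, Category.assoc, hKerE, hKerLift₁_top]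

theorem hKerI_c {A B : InternalGroupoid C} (F : A ⟶ B) : hKerI F ≫ hKerC F = hKerD F := by
  have := hKerI_comp F =≫ hKerC F
  rwa [hKerComp_c, Category.assoc, hKerE_c, Category.comp_id] at this

theorem comp_hKerI {A B : InternalGroupoid C} (F : A ⟶ B) :
    hKerComp F (hKerI F) (𝟙 _) (by rw [hKerI_c, Category.id_comp]) = hKerC F ≫ hKerE F := by
  apply hKer₁_ext
  · simp [hKerE, hKerI_d]
  · rw [hKerComp_top]
    refine (A.comp_congr (f' := hKerTop₁ F ≫ A.i) (g' := hKerTop₁ F) _ ?_ ?_).trans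
      ((A.inv_comp _).trans ?_)
    · simp [hKerI]
    · simp
    · rw [← Category.assoc, ← hKerC_top, Category.assoc, Category.assoc, hKerE, hKerLift₁_top]

theorem hKerComp_lift {A B : InternalGroupoid C} (F : A ⟶ B) {X : C} (f g : X ⟶ hKer₁ F)
    (h : f ≫ hKerC F = g ≫ hKerD F) :
    pullback.lift f g h ≫ hKerComp F (pullback.fst (hKerC F) (hKerD F))
      (pullback.snd (hKerC F) (hKerD F)) pullback.condition = hKerComp F f g h := by
  rw [hKerComp_precomp]
  congr 1
  · exact pullback.lift_fst _ _ _
  · exact pullback.lift_snd _ _ _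

/-- The explicit groupoid `𝕂(F)`. -/
noncomputable abbrev hKer {A B : InternalGroupoid C} (F : A ⟶ B) : InternalGroupoid C where
  obj := hKer₀ F
  arr := hKer₁ F
  d := hKerD F
  c := hKerC F
  e := hKerE F
  m := hKerComp F (pullback.fst (hKerC F) (hKerD F)) (pullback.snd (hKerC F) (hKerD F))
    pullback.condition
  i := hKerI F
  e_d := by simp [hKerE]
  e_c := hKerE_c F
  m_d := by simp
  m_c := hKerComp_c _ _ _ _
  id_m := by
    rw [hKerComp_lift]
    apply hKer₁_ext
    · simp [hKerE]
    · rw [hKerComp_top]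
      refine (A.comp_congr (f' := (hKerD F ≫ hKerTop₀ F) ≫ A.e) (g' := hKerTop₁ F) _ ?_ ?_).trans
        ((A.unit_comp _ _ (by simp)).trans (Category.id_comp _).symm)
      · simp [hKerE]
      · simp
  m_id := by
    rw [hKerComp_lift]
    apply hKer₁_ext
    · simp
    · rw [hKerComp_top]
      refine (A.comp_congr (f' := hKerTop₁ F) (g' := (hKerC F ≫ hKerTop₀ F) ≫ A.e) _ ?_ ?_).trans
        ((A.comp_unit _ _ (by simp)).trans (Category.id_comp _).symm)
      · simp
      · rw [hKerE, Category.assoc, hKerLift₁_top, Category.assoc]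
  m_assoc f g k hfg hgk := by
    simp only [hKerComp_lift]
    apply hKer₁_ext
    · simp
    · refine (hKerComp_top _ _ _ _).trans (Eq.trans ?_ (hKerComp_top _ _ _ _).symm)
      exact (A.comp_congr _ (hKerComp_top _ _ _ _) rfl).trans ((A.comp_assoc _ _ _
        (hKer_composable F hfg) (hKer_composable F hgk)).trans
        (A.comp_congr _ rfl (hKerComp_top _ _ _ _).symm))
  i_d := hKerI_d F
  i_c := hKerI_c F
  m_inv := by rw [hKerComp_lift, hKerI_comp]
  inv_m := by rw [hKerComp_lift, comp_hKerI]

theorem hKer_comp {A B : InternalGroupoid C} (F : A ⟶ B) {X : C} (f g : X ⟶ hKer₁ F)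
    (h : f ≫ hKerC F = g ≫ hKerD F) : (hKer F).comp f g h = hKerComp F f g h :=
  hKerComp_lift F f g h

/-- The functor `K(F) : 𝕂(F) ⟶ A`. -/
noncomputable abbrev hKerTop {A B : InternalGroupoid C} (F : A ⟶ B) : hKer F ⟶ A where
  map₀ := hKerTop₀ F
  map₁ := hKerTop₁ F
  map_d := hKerTop₁_d F
  map_c := (hKerC_top F).symm
  map_e := hKerLift₁_top _ _ _ _
  map_m := hKerComp_top _ _ _ pullback.condition

/-- The explicit square of the strong h-kernel. -/
noncomputable abbrev hKerSquare {A B : InternalGroupoid C} (F : A ⟶ B) :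
    HSquare F B.zeroFunctor where
  pt := hKer F
  top := hKerTop F
  left :=
    { map₀ := 0
      map₁ := 0
      map_d := (isZero_zero C).eq_of_tgt _ _
      map_c := (isZero_zero C).eq_of_tgt _ _
      map_e := (isZero_zero C).eq_of_tgt _ _
      map_m := (isZero_zero C).eq_of_tgt _ _ }
  cell :=
    { app := hKerCell F
      app_d := (hKerCell_d F).trans comp_zero.symm
      app_c := hKerCell_c F
      naturality := by
        have e1 : (0 : hKer₁ F ⟶ (0 : C)) ≫ ((0 : (0 : C) ⟶ B.obj) ≫ B.e) =
          (0 : hKer₁ F ⟶ B.obj) ≫ B.e := by simp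
        refine (B.comp_congr _ e1 rfl).trans ((B.unit_comp _ _ ?_).trans (hKerC_cell F))
        exact ((Category.assoc (hKerC F) (hKerCell F) B.d).trans
          ((congrArg (hKerC F ≫ ·) (hKerCell_d F)).trans comp_zero)).symm }

/-- Every internal functor has a strong h-kernel. -/
theorem isStrongHKernel_hKerSquare {A B : InternalGroupoid C} (F : A ⟶ B) :
    IsStrongHKernel (hKerSquare F) where
  existsUnique_functor R := by
    have hd : R.cell.app ≫ B.d = 0 := HSquare.cell_d R
    have hc : R.cell.app ≫ B.c = R.top.map₀ ≫ F.map₀ := R.cell.app_c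
    have h1 : (R.pt.d ≫ hKerLift F R.top.map₀ R.cell.app hd hc) ≫ hKerTop₀ F =
        R.top.map₁ ≫ A.d := by simp
    have hC : hKerLift₁ F (R.pt.d ≫ hKerLift F R.top.map₀ R.cell.app hd hc) R.top.map₁ h1 ≫
        hKerC F = R.pt.c ≫ hKerLift F R.top.map₀ R.cell.app hd hc := by
      apply hKer₀_ext
      · refine Eq.trans ?_ ((congrArg (R.pt.c ≫ ·) (hKerLift_cell _ _ _ _ _).symm).trans
          (Category.assoc _ _ _).symm)
        rw [Category.assoc, hKerC_cell, precomp]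
        have e1 : (R.left ≫ B.zeroFunctor).map₁ = (0 : R.pt.arr ⟶ B.obj) ≫ B.e :=
          comp_zeroFunctor_map₁ B R.left.map₁
        refine Eq.trans (B.comp_congr _ ?_ ?_) (R.cell.naturality.symm.trans
          ((B.comp_congr _ e1 rfl).trans (B.unit_comp _ _ ?_)))
        · rw [← Category.assoc, hKerLift₁_d, Category.assoc, hKerLift_cell]
        · rw [← Category.assoc, hKerLift₁_top]; rfl
        · rw [Category.assoc, hd, comp_zero]
      · simp
    let T : Functor R.pt (hKer F) :=
      { map₀ := hKerLift F R.top.map₀ R.cell.app hd hc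
        map₁ := hKerLift₁ F (R.pt.d ≫ hKerLift F R.top.map₀ R.cell.app hd hc) R.top.map₁ h1
        map_d := hKerLift₁_d _ _ _ _
        map_c := hC
        map_e := by
          apply hKer₁_ext
          · simp [hKerE]
          · simp [hKerE, R.top.map_e]
        map_m := by
          rw [hKer_comp]
          apply hKer₁_ext
          · rw [hKerComp_d, Category.assoc, Category.assoc, hKerLift₁_d, ← Category.assoc,
              R.pt.m_d, Category.assoc]
          · rw [hKerComp_top, Category.assoc, hKerLift₁_top, R.top.map_m]
            apply comp_congr <;> simp }
    refine ⟨T, ⟨?_, toDiscreteZero_ext _ _, hKerLift_cell _ _ _ hd hc⟩, ?_⟩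
    · exact hom_ext (hKerLift_top _ _ _ hd hc) (hKerLift₁_top _ _ _ _)
    · rintro S ⟨k1, _, k3⟩
      have h0 : S.map₀ = hKerLift F R.top.map₀ R.cell.app hd hc := by
        apply hKer₀_ext
        · exact Eq.trans k3 (hKerLift_cell _ _ _ _ _).symm
        · exact Eq.trans (congrArg Functor.map₀ k1) (hKerLift_top _ _ _ _ _).symm
      refine hom_ext h0 ?_
      apply hKer₁_ext
      · refine Eq.trans S.map_d (Eq.trans ?_ (hKerLift₁_d _ _ _ _).symm)
        rw [h0]
      · exact Eq.trans (congrArg Functor.map₁ k1) (hKerLift₁_top _ _ _ _).symm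
  existsUnique_natTrans {X} L M α β h := by
    have hL : L.map₀ ≫ hKerTop₀ F = β.app ≫ A.d := β.app_d.symm
    have e1 : (whiskerRight α B.zeroFunctor).app = (0 : X.obj ⟶ B.obj) ≫ B.e :=
      comp_zeroFunctor_map₁ B α.app
    have hM0 : (M.map₀ ≫ hKerCell F) ≫ B.d = 0 := by rw [Category.assoc, hKerCell_d, comp_zero]
    have hC : hKerLift₁ F L.map₀ β.app hL ≫ hKerC F = M.map₀ := by
      apply hKer₀_ext
      · rw [Category.assoc, hKerC_cell, precomp]
        refine Eq.trans (B.comp_congr _ ?_ ?_) (h.symm.trans ((B.comp_congr _ e1 rfl).trans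
          (B.unit_comp _ _ hM0.symm)))
        · rw [← Category.assoc, hKerLift₁_d]; rfl
        · rw [← Category.assoc, hKerLift₁_top]; rfl
      · rw [Category.assoc, hKerC_top, ← Category.assoc, hKerLift₁_top]
        exact β.app_c
    let μ : NatTrans L M :=
      { app := hKerLift₁ F L.map₀ β.app hL
        app_d := hKerLift₁_d _ _ _ _
        app_c := hC
        naturality := by
          rw [hKer_comp, hKer_comp]
          apply hKer₁_ext
          · rw [hKerComp_d, hKerComp_d, Category.assoc, hKerLift₁_d]
            exact L.map_d
          · rw [hKerComp_top, hKerComp_top]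
            refine Eq.trans (A.comp_congr _ rfl ?_) (β.naturality.trans (A.comp_congr _ ?_ rfl))
            · rw [Category.assoc, hKerLift₁_top]
            · rw [Category.assoc, hKerLift₁_top] }
    refine ⟨μ, ⟨?_, ?_⟩, ?_⟩
    · exact NatTrans.ext ((isZero_zero C).eq_of_tgt _ _)
    · exact NatTrans.ext (hKerLift₁_top _ _ _ _)
    · rintro ν ⟨_, k2⟩
      apply NatTrans.ext
      apply hKer₁_ext
      · exact ν.app_d.trans (hKerLift₁_d _ _ _ _).symm
      · exact (congrArg NatTrans.app k2).trans (hKerLift₁_top _ _ _ _).symm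

variable [HasReflexiveCoequalizers C]

/-- The connecting morphism `D = Δ · η : π₁(B) ⟶ π₀(𝕂(F))` of a strong h-kernel of `F`. -/
noncomputable def connecting {A B : InternalGroupoid C} {F : A ⟶ B}
    {K : HSquare F B.zeroFunctor} (hK : IsStrongHKernel K) : π₁.obj B ⟶ π₀.obj K.pt :=
  (existsUnique_delta hK).choose ≫ K.pt.η

end Kernel

end InternalGroupoid

/-- Exactness of `X ⟶ Y ⟶ Z` at `Y`: the composite is zero, and the factorization of `f` through
the kernel of `g` is a regular epimorphism. -/
def IsExactAt {C : Type u} [Category.{v} C] [HasFiniteLimits C] [HasZeroMorphisms C] {X Y Z : C}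
    (f : X ⟶ Y) (g : Y ⟶ Z) : Prop :=
  ∃ w : f ≫ g = 0, IsRegularEpi (kernel.lift g f w)

/-!
The six-term sequence is proved exact by chasing generalized elements. In a regular category,
regular epimorphisms are stable under pullback, so an element `T ⟶ Y` can be lifted along a regular
epimorphism `X ⟶ Y` after passing to a regular epimorphic cover of `T`
(`exists_lift_of_isRegularEpi`). Conversely, a sequence `X ⟶ Y ⟶ Z` with zero composite is exact as
soon as every element of `Y` killed in `Z` lifts to `X` after passing to such a cover
(`isExactAt_of_forall_exists_lift`).

The arguments are then those for ordinary groupoids. By the one-dimensional universal property, an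
object of `𝕂(F)` is a pair of an object `a` of `A` and an arrow `b : 0 ⟶ F a` of `B`. By the
two-dimensional one, an arrow `(a, b) ⟶ (a', b')` is an arrow `f : a ⟶ a'` of `A` with
`b · F f = b'` (`HSquare.cell_arr` and `IsStrongHKernel.exists_arr`). The morphism `Δ` sends an
automorphism `b` of `0` to the object `(0, b)`. Properness enters through
`IsProper.exists_arr`: two elements identified in `π₀` are, after a cover, connected by an arrow.
It is used for `𝕂(F)` at `π₁(B)`, for `A` at `π₀(𝕂(F))` and for `B` at `π₀(A)`; exactness at
`π₁(A)` follows from the universal property alone.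
-/

/-! ### Generalized elements in a regular category -/

section Regular

variable {C : Type u} [Category.{v} C] [Regular C]

/-- In a regular category, the composite of two regular epimorphisms is a regular epimorphism. -/
theorem isRegularEpi_comp_of_regular {X Y Z : C} {f : X ⟶ Y} {g : Y ⟶ Z} (hf : IsRegularEpi f)
    (hg : IsRegularEpi g) : IsRegularEpi (f ≫ g) := by
  have : StrongEpi (f ≫ g) := strongEpi_comp f g
  infer_instance

/-- A generalized element of the codomain of a regular epimorphism lifts to the domain after
passing to a regular epimorphic cover. -/
theorem exists_lift_of_isRegularEpi {X Y T : C} {f : X ⟶ Y} (hf : IsRegularEpi f) (t : T ⟶ Y) :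
    ∃ (W : C) (p : W ⟶ T) (x : W ⟶ X), IsRegularEpi p ∧ x ≫ f = p ≫ t :=
  ⟨pullback f t, pullback.snd f t, pullback.fst f t, inferInstance, pullback.condition⟩

/-- In a regular category, a morphism through which a regular epimorphism factors is itself a
regular epimorphism. -/
theorem isRegularEpi_of_isRegularEpi_fac {W X Y : C} {f : X ⟶ Y} (x : W ⟶ X) {p : W ⟶ Y}
    (hp : IsRegularEpi p) (h : x ≫ f = p) : IsRegularEpi f := by
  have : StrongEpi (x ≫ f) := by rw [h]; infer_instance
  have : StrongEpi f := strongEpi_of_strongEpi x f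
  infer_instance

theorem isExactAt_of_forall_exists_lift [HasZeroMorphisms C] {X Y Z : C} {f : X ⟶ Y} {g : Y ⟶ Z}
    (w : f ≫ g = 0)
    (h : ∀ {T : C} (y : T ⟶ Y), y ≫ g = 0 →
      ∃ (W : C) (p : W ⟶ T) (x : W ⟶ X), IsRegularEpi p ∧ x ≫ f = p ≫ y) :
    IsExactAt f g := by
  refine ⟨w, ?_⟩
  obtain ⟨W, p, x, hp, hx⟩ := h (kernel.ι g) (kernel.condition g)
  refine isRegularEpi_of_isRegularEpi_fac x hp ?_
  rw [← cancel_mono (kernel.ι g), Category.assoc, kernel.lift_ι, hx]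

end Regular

namespace InternalGroupoid

/-! ### Elements of `π₀` and `π₁` -/

section Pi

variable {C : Type u} [Category.{v} C]

/-- The quotient `η`, with codomain written as `π₀.obj B` rather than as the coequalizer that it
unfolds to, so that it composes syntactically with values of the functor `π₀`. -/
noncomputable def toπ₀ [HasFiniteLimits C] [HasReflexiveCoequalizers C] (B : InternalGroupoid C) :
    B.obj ⟶ π₀.obj B :=
  B.η

theorem isRegularEpi_toπ₀ [HasFiniteLimits C] [HasReflexiveCoequalizers C]
    (B : InternalGroupoid C) : IsRegularEpi B.toπ₀ :=
  inferInstanceAs (IsRegularEpi (coequalizer.π B.d B.c))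

theorem toπ₀_map [HasFiniteLimits C] [HasReflexiveCoequalizers C] {A B : InternalGroupoid C}
    (F : A ⟶ B) : A.toπ₀ ≫ π₀.map F = F.map₀ ≫ B.toπ₀ :=
  η_π₀_map F

theorem comp_toπ₀_eq_of_arr [HasFiniteLimits C] [HasReflexiveCoequalizers C]
    {B : InternalGroupoid C} {T : C} (f : T ⟶ B.arr) :
    (f ≫ B.d) ≫ B.toπ₀ = (f ≫ B.c) ≫ B.toπ₀ := by
  rw [Category.assoc, Category.assoc]
  exact congrArg (f ≫ ·) B.η_condition

/-- In a proper groupoid, two objects with the same class in `π₀` are connected by an arrow after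
passing to a regular epimorphic cover. -/
theorem IsProper.exists_arr [Regular C] [HasReflexiveCoequalizers C] {B : InternalGroupoid C}
    (hB : B.IsProper) {T : C} (x y : T ⟶ B.obj) (h : x ≫ B.toπ₀ = y ≫ B.toπ₀) :
    ∃ (W : C) (p : W ⟶ T) (f : W ⟶ B.arr),
      IsRegularEpi p ∧ f ≫ B.d = p ≫ x ∧ f ≫ B.c = p ≫ y := by
  have h' : x ≫ B.η = y ≫ B.η := h
  obtain ⟨W, p, f, hp, hf⟩ := exists_lift_of_isRegularEpi hB (pullback.lift x y h')
  refine ⟨W, p, f, hp, ?_, ?_⟩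
  · simpa only [Category.assoc, pullback.lift_fst] using hf =≫ pullback.fst B.η B.η
  · simpa only [Category.assoc, pullback.lift_snd] using hf =≫ pullback.snd B.η B.η

variable [HasFiniteLimits C] [HasZeroMorphisms C]

/-- The inclusion `ε`, with domain written as `π₁.obj B` rather than as the kernel that it unfolds
to, so that it composes syntactically with values of the functor `π₁`. -/
noncomputable def π₁ι (B : InternalGroupoid C) : π₁.obj B ⟶ B.arr :=
  B.ε

instance (B : InternalGroupoid C) : Mono B.π₁ι :=
  inferInstanceAs (Mono (kernel.ι (prod.lift B.d B.c)))

@[simp]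
theorem π₁ι_d (B : InternalGroupoid C) : B.π₁ι ≫ B.d = 0 :=
  B.ε_d

@[simp]
theorem π₁ι_c (B : InternalGroupoid C) : B.π₁ι ≫ B.c = 0 :=
  B.ε_c

theorem π₁_map_ι {A B : InternalGroupoid C} (F : A ⟶ B) :
    π₁.map F ≫ B.π₁ι = A.π₁ι ≫ F.map₁ :=
  π₁_map_ε F

theorem exists_comp_π₁ι {B : InternalGroupoid C} {T : C} (b : T ⟶ B.arr) (hd : b ≫ B.d = 0)
    (hc : b ≫ B.c = 0) : ∃ b' : T ⟶ π₁.obj B, b' ≫ B.π₁ι = b :=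
  ⟨kernel.lift (prod.lift B.d B.c) b (by
    ext
    · rw [Category.assoc, prod.lift_fst, hd, zero_comp]
    · rw [Category.assoc, prod.lift_snd, hc, zero_comp]), kernel.lift_ι _ _ _⟩

/-- The zero generalized arrow is the identity of the base point `0`, hence a left unit. -/
theorem zero_comp_arr (B : InternalGroupoid C) {T : C} (f : T ⟶ B.arr) (h : f ≫ B.d = 0) :
    B.comp 0 f (by rw [h, zero_comp]) = f :=
  (B.comp_congr _ zero_comp.symm rfl).trans (B.unit_comp 0 f h.symm)

end Pi

/-! ### Objects and arrows of the strong h-kernel -/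

section HKernel

variable {C : Type u} [Category.{v} C] [HasFiniteLimits C] [HasZeroObject C] [HasZeroMorphisms C]
  {A B : InternalGroupoid C} {F : A ⟶ B} {K : HSquare F B.zeroFunctor}

@[simp]
theorem HSquare.cell_c (K : HSquare F B.zeroFunctor) :
    K.cell.app ≫ B.c = K.top.map₀ ≫ F.map₀ :=
  K.cell.app_c

theorem HSquare.comp_cell_d (K : HSquare F B.zeroFunctor) {T : C} (x : T ⟶ K.pt.obj) :
    (x ≫ K.cell.app) ≫ B.d = 0 :=
  (Category.assoc _ _ _).trans ((congrArg (x ≫ ·) K.cell_d).trans comp_zero)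

theorem HSquare.cell_arr_composable (K : HSquare F B.zeroFunctor) {T : C} (k : T ⟶ K.pt.arr) :
    ((k ≫ K.pt.d) ≫ K.cell.app) ≫ B.c = ((k ≫ K.top.map₁) ≫ F.map₁) ≫ B.d := by
  simp only [Category.assoc, HSquare.cell_c, map_d]
  rw [← Category.assoc K.top.map₁, map_d, Category.assoc]

/-- Naturality of the 2-cell `0 ⇒ K(F) · F`: an arrow of `𝕂(F)` from `(a, b)` to `(a', b')`
lying over `f` satisfies `b · F f = b'`. -/
theorem HSquare.cell_arr (K : HSquare F B.zeroFunctor) {T : C} (k : T ⟶ K.pt.arr) :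
    (k ≫ K.pt.c) ≫ K.cell.app =
      B.comp ((k ≫ K.pt.d) ≫ K.cell.app) ((k ≫ K.top.map₁) ≫ F.map₁)
        (K.cell_arr_composable k) := by
  have h := k ≫= K.cell.naturality
  rw [precomp, precomp] at h
  have e : k ≫ (K.left ≫ B.zeroFunctor).map₁ = 0 :=
    (congrArg (k ≫ ·) ((comp_zeroFunctor_map₁ B K.left.map₁).trans zero_comp)).trans comp_zero
  calc (k ≫ K.pt.c) ≫ K.cell.app
      = B.comp 0 ((k ≫ K.pt.c) ≫ K.cell.app) (by rw [K.comp_cell_d, zero_comp]) :=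
        (B.zero_comp_arr _ (K.comp_cell_d _)).symm
    _ = _ := (B.comp_congr _ e.symm (Category.assoc _ _ _)).trans
        (h.trans (B.comp_congr _ (Category.assoc _ _ _).symm (by simp)))

/-- A generalized arrow `f : x ⟶ y` of `A`, seen as a natural transformation between functors out
of a discrete groupoid. -/
def discreteNatTrans {T : C} {L M : discrete T ⟶ A} (f : T ⟶ A.arr) (hd : f ≫ A.d = L.map₀)
    (hc : f ≫ A.c = M.map₀) : NatTrans L M where
  app := f
  app_d := hd
  app_c := hc
  naturality := by
    have hL : L.map₁ = L.map₀ ≫ A.e := (Category.id_comp L.map₁).symm.trans L.map_e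
    have hM : M.map₁ = M.map₀ ≫ A.e := (Category.id_comp M.map₁).symm.trans M.map_e
    exact (A.comp_congr _ hL (Category.id_comp f)).trans ((A.unit_comp _ _ hd.symm).trans
      ((A.comp_congr _ (Category.id_comp f) hM).trans (A.comp_unit _ _ hc)).symm)

/-- An arrow `f` of `A` with `b · F f = b'` underlies an arrow `(a, b) ⟶ (a', b')` of `𝕂(F)`. -/
theorem IsStrongHKernel.exists_arr (hK : IsStrongHKernel K) {T : C} (x y : T ⟶ K.pt.obj)
    (f : T ⟶ A.arr) (hd : f ≫ A.d = x ≫ K.top.map₀) (hc : f ≫ A.c = y ≫ K.top.map₀)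
    (h : y ≫ K.cell.app = B.comp (x ≫ K.cell.app) (f ≫ F.map₁)
      (by simp [reassoc_of% hd])) :
    ∃ k : T ⟶ K.pt.arr, k ≫ K.pt.d = x ∧ k ≫ K.pt.c = y ∧ k ≫ K.top.map₁ = f := by
  -- The component over the zero groupoid carries no information.
  let α : NatTrans (ofDiscrete K.pt x ≫ K.left) (ofDiscrete K.pt y ≫ K.left) :=
    discreteNatTrans 0 ((isZero_zero C).eq_of_tgt _ _) ((isZero_zero C).eq_of_tgt _ _)
  let β : NatTrans (ofDiscrete K.pt x ≫ K.top) (ofDiscrete K.pt y ≫ K.top) :=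
    discreteNatTrans f hd hc
  have e : (whiskerRight α B.zeroFunctor).app = 0 :=
    (comp_zeroFunctor_map₁ B α.app).trans zero_comp
  obtain ⟨μ, ⟨_, hμ⟩, _⟩ := hK.existsUnique_natTrans (ofDiscrete K.pt x) (ofDiscrete K.pt y) α β
    ((B.comp_congr _ e rfl).trans ((B.zero_comp_arr (y ≫ K.cell.app) (K.comp_cell_d y)).trans h))
  exact ⟨μ.app, μ.app_d, μ.app_c, congrArg NatTrans.app hμ⟩

/-- The connecting morphism factors through a morphism `Δ` with the defining properties of
`existsUnique_delta`. -/
theorem exists_connecting_eq [HasReflexiveCoequalizers C] (hK : IsStrongHKernel K) :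
    ∃ Δ : π₁.obj B ⟶ K.pt.obj, Δ ≫ K.cell.app = B.π₁ι ∧ Δ ≫ K.top.map₀ = 0 ∧
      connecting hK = Δ ≫ K.pt.toπ₀ :=
  ⟨_, (existsUnique_delta hK).choose_spec.1.1, (existsUnique_delta hK).choose_spec.1.2, rfl⟩

end HKernel

/-! ### Exactness of the six-term sequence -/

section Exactness

variable {C : Type u} [Category.{v} C] [HasZeroObject C] [HasZeroMorphisms C] [Regular C]
  {A B : InternalGroupoid C} {F : A ⟶ B} {K : HSquare F B.zeroFunctor}

/-- An automorphism `a` of `0` in `A` with `F a = 0` is an automorphism of the object `(0, 0)` of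
`𝕂(F)`. No cover is needed here. -/
theorem isExactAt_π₁_source (hK : IsStrongHKernel K) : IsExactAt (π₁.map K.top) (π₁.map F) := by
  refine isExactAt_of_forall_exists_lift ?_ fun {T} a ha => ?_
  · rw [← cancel_mono B.π₁ι, Category.assoc, π₁_map_ι, ← Category.assoc, π₁_map_ι, zero_comp]
    have h := K.cell_arr K.pt.π₁ι
    rw [B.comp_congr (f' := 0) _ (by simp) rfl, zero_comp_arr] at h
    · simpa using h.symm
    · rw [← K.cell_arr_composable]
      simp
  · have hF : (a ≫ A.π₁ι) ≫ F.map₁ = 0 := by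
      rw [Category.assoc, ← π₁_map_ι, ← Category.assoc, ha, zero_comp]
    obtain ⟨k, hd, hc, hk⟩ := hK.exists_arr (0 : T ⟶ K.pt.obj) 0 (a ≫ A.π₁ι) (by simp) (by simp)
      (by rw [B.comp_congr (f' := 0) (g' := 0) _ zero_comp hF, zero_comp_arr _ _ zero_comp,
        zero_comp])
    obtain ⟨k', rfl⟩ := exists_comp_π₁ι k hd hc
    refine ⟨T, 𝟙 T, k', inferInstance, ?_⟩
    rw [← cancel_mono A.π₁ι, Category.assoc, π₁_map_ι, ← Category.assoc, hk, Category.id_comp]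

variable [HasReflexiveCoequalizers C]

/-- If `(0, b)` has the class of `(0, 0)`, properness of `𝕂(F)` connects them by an arrow
`(0, 0) ⟶ (0, b)`, which is an automorphism `a` of `0` in `A` with `F a = b`. -/
theorem isExactAt_π₁_target (hK : IsStrongHKernel K) (hKp : K.pt.IsProper) :
    IsExactAt (π₁.map F) (connecting hK) := by
  obtain ⟨Δ, hcell, htop, hD⟩ := exists_connecting_eq hK
  rw [hD]
  refine isExactAt_of_forall_exists_lift ?_ fun {T} b hb => ?_
  · -- An automorphism `a` of `0` in `A` is an arrow `(0, 0) ⟶ (0, F a)` of `𝕂(F)`.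
    obtain ⟨k, hd, hc, -⟩ := hK.exists_arr (0 : π₁.obj A ⟶ K.pt.obj) (π₁.map F ≫ Δ) A.π₁ι
      (by simp) (by simp [htop]) (by
        rw [B.comp_congr (f' := 0) _ zero_comp rfl, zero_comp_arr _ _ (by simp [← π₁_map_ι]),
          Category.assoc, hcell, π₁_map_ι])
    rw [← Category.assoc, ← hc, ← comp_toπ₀_eq_of_arr, hd, zero_comp]
  · obtain ⟨W, p, k, hp, hd, hc⟩ := hKp.exists_arr 0 (b ≫ Δ)
      (by rw [zero_comp, Category.assoc, hb])
    rw [comp_zero] at hd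
    obtain ⟨a, ha⟩ := exists_comp_π₁ι (k ≫ K.top.map₁)
      (by rw [Category.assoc, map_d, ← Category.assoc, hd, zero_comp])
      (by rw [Category.assoc, map_c, ← Category.assoc, hc]; simp [htop])
    refine ⟨W, p, a, hp, ?_⟩
    have h := K.cell_arr k
    rw [B.comp_congr (f' := 0) _ (by rw [hd, zero_comp]) rfl, zero_comp_arr] at h
    · rw [← cancel_mono B.π₁ι, Category.assoc, π₁_map_ι, ← Category.assoc, ha, ← h, hc]
      simp [hcell]
    · rw [← K.cell_arr_composable, hd, zero_comp, zero_comp]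

/-- If the class of `a₀` in `π₀(A)` is zero, properness of `A` connects `a₀` to `0`, and an object
`(a₀, b)` of `𝕂(F)` can be transported along this arrow to an object of the form `(0, b')`. -/
theorem isExactAt_π₀_hKernel (hK : IsStrongHKernel K) (hA : A.IsProper) :
    IsExactAt (connecting hK) (π₀.map K.top) := by
  obtain ⟨Δ, hcell, htop, hD⟩ := exists_connecting_eq hK
  rw [hD]
  refine isExactAt_of_forall_exists_lift ?_ fun {T} x hx => ?_
  · rw [Category.assoc, toπ₀_map, ← Category.assoc, htop, zero_comp]
  · obtain ⟨W, p, y, hp, hy⟩ := exists_lift_of_isRegularEpi K.pt.isRegularEpi_toπ₀ x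
    obtain ⟨W', q, a, hq, hd, hc⟩ := hA.exists_arr (y ≫ K.top.map₀) 0 (by
      rw [Category.assoc, ← toπ₀_map, ← Category.assoc, hy, Category.assoc, hx, comp_zero,
        zero_comp])
    rw [comp_zero] at hc
    -- Transporting the object `y = (a₀, b)` along `a : a₀ ⟶ 0` gives `(0, b · F a)`, an object in
    -- the image of `Δ`.
    have hcomp : ((q ≫ y) ≫ K.cell.app) ≫ B.c = (a ≫ F.map₁) ≫ B.d := by
      simp [reassoc_of% hd]
    obtain ⟨b, hb⟩ := exists_comp_π₁ι (B.comp ((q ≫ y) ≫ K.cell.app) (a ≫ F.map₁) hcomp)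
      (by rw [comp_d, K.comp_cell_d]) (by simp [reassoc_of% hc])
    obtain ⟨k, hkd, hkc, -⟩ := hK.exists_arr (q ≫ y) (b ≫ Δ) a (by simp [hd])
      (by simp [htop, hc]) (by rw [Category.assoc, hcell, hb])
    refine ⟨W', q ≫ p, b, isRegularEpi_comp_of_regular hq hp, ?_⟩
    rw [← Category.assoc, ← hkc, ← comp_toπ₀_eq_of_arr, hkd, Category.assoc, hy, Category.assoc]

/-- If the class of `F a` in `π₀(B)` is zero, properness of `B` gives an arrow `b : 0 ⟶ F a`, so
that `(a, b)` is an object of `𝕂(F)` over `a`. -/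
theorem isExactAt_π₀_source (hK : IsStrongHKernel K) (hB : B.IsProper) :
    IsExactAt (π₀.map K.top) (π₀.map F) := by
  refine isExactAt_of_forall_exists_lift ?_ fun {T} x hx => ?_
  · have : Epi K.pt.toπ₀ := by
      have := K.pt.isRegularEpi_toπ₀
      infer_instance
    rw [← cancel_epi K.pt.toπ₀, ← Category.assoc, toπ₀_map, Category.assoc, toπ₀_map,
      ← Category.assoc, ← HSquare.cell_c, ← comp_toπ₀_eq_of_arr, HSquare.cell_d, zero_comp,
      comp_zero]
  · obtain ⟨W, p, y, hp, hy⟩ := exists_lift_of_isRegularEpi A.isRegularEpi_toπ₀ x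
    obtain ⟨W', q, b, hq, hd, hc⟩ := hB.exists_arr 0 (y ≫ F.map₀) (by
      rw [Category.assoc, ← toπ₀_map, ← Category.assoc, hy, Category.assoc, hx, comp_zero,
        zero_comp])
    rw [comp_zero] at hd
    obtain ⟨z, ⟨-, hz⟩, -⟩ := existsUnique_toHKernel hK (q ≫ y) b hd (by simp [hc])
    refine ⟨W', q ≫ p, z ≫ K.pt.toπ₀, isRegularEpi_comp_of_regular hq hp, ?_⟩
    rw [Category.assoc, toπ₀_map, ← Category.assoc, hz, Category.assoc, hy, Category.assoc]

end Exactness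

end InternalGroupoid

theorem mainTheorem1 {C : Type u} [Category.{v} C] [HasZeroObject C] [HasZeroMorphisms C]
    [Regular C] [HasReflexiveCoequalizers C] {A B : InternalGroupoid C} (F : A ⟶ B)
    (K : InternalGroupoid.HSquare F B.zeroFunctor) (hK : InternalGroupoid.IsStrongHKernel K)
    (hA : A.IsProper) (hB : B.IsProper) (hKp : K.pt.IsProper) :
    IsExactAt (InternalGroupoid.π₁.map K.top) (InternalGroupoid.π₁.map F) ∧
    IsExactAt (InternalGroupoid.π₁.map F) (InternalGroupoid.connecting hK) ∧
    IsExactAt (InternalGroupoid.connecting hK) (InternalGroupoid.π₀.map K.top) ∧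
    IsExactAt (InternalGroupoid.π₀.map K.top) (InternalGroupoid.π₀.map F) :=
  ⟨InternalGroupoid.isExactAt_π₁_source hK, InternalGroupoid.isExactAt_π₁_target hK hKp,
    InternalGroupoid.isExactAt_π₀_hKernel hK hA, InternalGroupoid.isExactAt_π₀_source hK hB⟩
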